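/- There are absolute constants $c, C > 0$ such that for every integer $n > 1$ and every real $0 < \varepsilon < 1/2$ there is a set $V \subset \mathbb{R}^n$ with exactly $N = |V| = n^3 + n$ points such that the following hold ($\|\cdot\|$ is the Euclidean norm). (a) $V$ contains the standard basis vectors $e_1, \dots, e_n$, and each of the remaining $n^3$ vectors $v \in V$ satisfies $\bigl|\|v\|^2 - n\bigr| \le C\sqrt{n \log n}$. (b) For every integer $m \ge 0$ and every matrix $A \in \mathbb{R}^{m \times n}$ such that $(1-\varepsilon)\|v\|^2 \le \|Av\|^2 \le (1+\varepsilon)\|v\|^2$ for all $v \in V$, one has $$m \ge c \min\{n, \varepsilon^{-2}\log n\} \quad\text{and}\quad m \ge c\min\{n, \varepsilon^{-2}\log N\}.$$ (c) Consequently, for every integer $m \ge 0$, if a linear map $f : \mathbb{R}^n \to \mathbb{R}^m$ has the Johnson--Lindenstrauss guarantee $(1-\varepsilon)\|x-y\|^2 \le \|f(x)-f(y)\|^2 \le (1+\varepsilon)\|x-y\|^2$ for all $x, y \in V \cup \{0\}$, then $m$ satisfies the same two lower bounds. -/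

import Mathlib

/-- `A : ℝ^{m × n}` preserves squared Euclidean norms on `V` up to a factor `1 ± ε`:
`(1 - ε) ‖v‖₂² ≤ ‖A v‖₂² ≤ (1 + ε) ‖v‖₂²` for every `v ∈ V`. -/
def PreservesNorms {m n : ℕ} (ε : ℝ) (A : Matrix (Fin m) (Fin n) ℝ)
    (V : Set (EuclideanSpace ℝ (Fin n))) : Prop :=
  ∀ v ∈ V,
    (1 - ε) * ‖v‖ ^ 2 ≤ ‖(WithLp.toLp 2 (A.mulVec v.ofLp) : EuclideanSpace ℝ (Fin m))‖ ^ 2 ∧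
    ‖(WithLp.toLp 2 (A.mulVec v.ofLp) : EuclideanSpace ℝ (Fin m))‖ ^ 2 ≤ (1 + ε) * ‖v‖ ^ 2

/-- `f` has the `ε`-Johnson–Lindenstrauss guarantee for `X`: all squared Euclidean distances
between points of `X` are preserved up to a factor `1 ± ε`. -/
def HasJLGuarantee {m n : ℕ} (ε : ℝ) (X : Set (EuclideanSpace ℝ (Fin n)))
    (f : EuclideanSpace ℝ (Fin n) → EuclideanSpace ℝ (Fin m)) : Prop :=
  ∀ x ∈ X, ∀ y ∈ X,
    (1 - ε) * ‖x - y‖ ^ 2 ≤ ‖f x - f y‖ ^ 2 ∧ ‖f x - f y‖ ^ 2 ≤ (1 + ε) * ‖x - y‖ ^ 2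

/-! Let `G` be the Gram matrix of the columns `A e_i`. It has rank at most `m`, so `(tr G)² ≤ m
‖G‖_F²`; near-isometry at the `e_i` gives `tr G ≥ n/2`. It remains to force `‖G - I‖_F` to be small
using few test vectors. Cut the coordinates into about `n/h` blocks of size at most `h`. On a block,
`5 ^ h` net vectors `x` detect the norm of a column of `G - I`. Polarization at `x`, `e_j` and `x +
e_j` bounds this norm by `10ε` for column `j`. Summing, `‖G - I‖_F² ≲ n² ε² / h`, whence `m ≳ min n
(h / ε²)`. This uses at most `n (n + 1) 5 ^ h` directions, which fit into `n ^ 3` for `h` of order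
`log n`. Only directions matter, so all are rescaled to norm exactly `√n`, and `V` is deterministic
and independent of `ε`. -/

open scoped RealInnerProductSpace

/-! ### Nets and norming sets -/

/-- In a finite-dimensional real normed space, the ball of radius `2` has a `1`-net inside it with
at most `5 ^ dim` points. -/
theorem exists_finset_net_closedBall_two (E : Type*) [NormedAddCommGroup E] [NormedSpace ℝ E]
    [FiniteDimensional ℝ E] :
    ∃ s : Finset E, s.card ≤ 5 ^ Module.finrank ℝ E ∧ (∀ x ∈ s, ‖x‖ ≤ 2) ∧
      ∀ u : E, ‖u‖ ≤ 2 → ∃ x ∈ s, ‖x - u‖ < 1 := by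
  classical
  -- A `1`-separated set of maximal cardinality is a `1`-net.
  let P : ℕ → Prop := fun k => ∃ s : Finset E, s.card = k ∧ (∀ x ∈ s, ‖x‖ ≤ 2) ∧
    ∀ x ∈ s, ∀ y ∈ s, x ≠ y → 1 ≤ ‖x - y‖
  have hP0 : P 0 := ⟨∅, by simp⟩
  obtain ⟨s, hcard, hs, hsep⟩ : P (Nat.findGreatest P (5 ^ Module.finrank ℝ E)) :=
    Nat.findGreatest_spec (Nat.zero_le _) hP0
  refine ⟨s, Besicovitch.card_le_of_separated s hs hsep, hs, fun u hu => ?_⟩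
  by_contra! hfar
  have hus : u ∉ s := fun h => by
    have := hfar u h
    simp at this
    linarith
  have hs' : ∀ x ∈ insert u s, ‖x‖ ≤ 2 := by
    simpa [hu] using hs
  have hsep' : ∀ x ∈ insert u s, ∀ y ∈ insert u s, x ≠ y → 1 ≤ ‖x - y‖ := by
    intro x hx y hy hxy
    rcases Finset.mem_insert.1 hx with hxu | hx <;> rcases Finset.mem_insert.1 hy with hyu | hy
    · exact absurd (hxu.trans hyu.symm) hxy
    · rw [hxu, norm_sub_rev]; exact hfar y hy
    · rw [hyu]; exact hfar x hx
    · exact hsep x hx y hy hxy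
  have hle := Nat.le_findGreatest (Besicovitch.card_le_of_separated _ hs' hsep')
    (show P _ from ⟨_, rfl, hs', hsep'⟩)
  rw [Finset.card_insert_of_notMem hus] at hle
  omega

/-- At most `5 ^ #T` vectors of norm at most `2` suffice to detect, up to a constant factor, the
Euclidean norm of the restriction to `T` of any vector. -/
theorem exists_finset_norming_coordinates {ι : Type*} [Fintype ι] (T : Finset ι) :
    ∃ s : Finset (EuclideanSpace ℝ ι), s.card ≤ 5 ^ T.card ∧ (∀ x ∈ s, ‖x‖ ≤ 2) ∧
      ∀ g : ι → ℝ, ∃ x ∈ s, 3 / 4 * √(∑ i ∈ T, g i ^ 2) ≤ ∑ i, x i * g i := by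
  classical
  obtain ⟨s, hcard, hs, hnet⟩ := exists_finset_net_closedBall_two (EuclideanSpace ℝ T)
  let ext : EuclideanSpace ℝ T → EuclideanSpace ℝ ι := fun x =>
    WithLp.toLp 2 fun i => if h : i ∈ T then x ⟨i, h⟩ else 0
  have hsum : ∀ F : ι → ℝ, (∀ i ∉ T, F i = 0) → ∑ i, F i = ∑ i : T, F i := by
    intro F hF
    rw [Finset.sum_coe_sort T F]
    exact (Finset.sum_subset (Finset.subset_univ T) fun i _ hi => hF i hi).symm
  have hext : ∀ x, ‖ext x‖ = ‖x‖ := by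
    intro x
    rw [EuclideanSpace.norm_eq, EuclideanSpace.norm_eq, hsum _ (by simp +contextual [ext])]
    simp [ext]
  refine ⟨s.image ext, Finset.card_image_le.trans (by simpa using hcard), ?_, fun g => ?_⟩
  · simpa [hext] using hs
  let w : EuclideanSpace ℝ T := WithLp.toLp 2 fun i => g i
  have hw : √(∑ i ∈ T, g i ^ 2) = ‖w‖ := by
    rw [EuclideanSpace.norm_eq, ← Finset.sum_coe_sort T (fun i => g i ^ 2)]
    simp [w]
  have hpair : ∀ x, ∑ i, ext x i * g i = ⟪x, w⟫ := by
    intro x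
    rw [hsum _ (by simp +contextual [ext])]
    simp [ext, w, PiLp.inner_apply, mul_comm]
  suffices h : ∃ x ∈ s, 3 / 4 * ‖w‖ ≤ ⟪x, w⟫ by
    obtain ⟨x, hx, h⟩ := h
    exact ⟨ext x, Finset.mem_image_of_mem _ hx, by rw [hw, hpair]; exact h⟩
  rcases eq_or_ne w 0 with h0 | h0
  · obtain ⟨x, hx, -⟩ := hnet 0 (by simp)
    exact ⟨x, hx, by simp [h0]⟩
  have hpos : 0 < ‖w‖ := norm_pos_iff.2 h0
  -- If `u` is `w` rescaled to norm `2` and `‖x - u‖ ≤ 1`, then `2⟪x, u⟫ ≥ 4 - 1`: this is the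
  -- source of `3 / 4`.
  have hu : ‖(2 / ‖w‖) • w‖ = 2 := by
    rw [norm_smul, norm_div, norm_norm, Real.norm_ofNat, div_mul_cancel₀ _ hpos.ne']
  obtain ⟨x, hx, hlt⟩ := hnet _ hu.le
  refine ⟨x, hx, ?_⟩
  have hexp := norm_sub_sq_real x ((2 / ‖w‖) • w)
  rw [hu, inner_smul_right] at hexp
  have hsq : ‖x - (2 / ‖w‖) • w‖ ^ 2 ≤ 1 := by
    have := norm_nonneg (x - (2 / ‖w‖) • w)
    nlinarith
  have h3 : 3 / 2 ≤ 2 / ‖w‖ * ⟪x, w⟫ := by nlinarith [sq_nonneg ‖x‖]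
  rw [div_mul_eq_mul_div, le_div_iff₀ hpos] at h3
  linarith

/-! ### Gram matrices and near-isometries -/

/-- The squared trace of a Gram matrix of vectors in `ℝ^m` is at most `m` times its squared
Frobenius norm. -/
theorem sq_sum_norm_sq_le_card_mul_sum_inner_sq {ι κ : Type*} [Fintype ι] [Fintype κ]
    (a : ι → EuclideanSpace ℝ κ) :
    (∑ i, ‖a i‖ ^ 2) ^ 2 ≤ Fintype.card κ * ∑ i, ∑ j, ⟪a i, a j⟫ ^ 2 := by
  -- The `m × m` matrix `∑ a_i a_iᵀ` has the same trace and Frobenius norm as the Gram matrix; apply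
  -- Cauchy–Schwarz to its diagonal.
  have htr : ∑ i, ‖a i‖ ^ 2 = ∑ r, ∑ i, a i r * a i r := by
    rw [Finset.sum_comm]
    simp [EuclideanSpace.real_norm_sq_eq, ← pow_two]
  have hgram : ∑ i, ∑ j, ⟪a i, a j⟫ ^ 2 = ∑ r, ∑ t, (∑ i, a i r * a i t) ^ 2 := by
    simp only [PiLp.inner_apply, pow_two, Finset.sum_mul_sum, RCLike.inner_apply, conj_trivial]
    calc _ = ∑ i, ∑ r, ∑ j, ∑ t, a j r * a i r * (a j t * a i t) :=
          Finset.sum_congr rfl fun i _ => Finset.sum_comm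
      _ = ∑ r, ∑ i, ∑ j, ∑ t, a j r * a i r * (a j t * a i t) := Finset.sum_comm
      _ = ∑ r, ∑ i, ∑ t, ∑ j, a j r * a i r * (a j t * a i t) :=
          Finset.sum_congr rfl fun r _ => Finset.sum_congr rfl fun i _ => Finset.sum_comm
      _ = ∑ r, ∑ t, ∑ i, ∑ j, a j r * a i r * (a j t * a i t) :=
          Finset.sum_congr rfl fun r _ => Finset.sum_comm
      _ = _ := by
          refine Finset.sum_congr rfl fun r _ => Finset.sum_congr rfl fun t _ =>
            Finset.sum_congr rfl fun i _ => Finset.sum_congr rfl fun j _ => ?_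
          ring
  rw [htr, hgram]
  calc (∑ r, ∑ i, a i r * a i r) ^ 2
      ≤ Fintype.card κ * ∑ r, (∑ i, a i r * a i r) ^ 2 := by
        simpa using sq_sum_le_card_mul_sum_sq (s := Finset.univ)
          (f := fun r => ∑ i, a i r * a i r)
    _ ≤ _ := by
        gcongr with r
        exact Finset.single_le_sum (f := fun t => (∑ i, a i r * a i t) ^ 2)
          (fun t _ => sq_nonneg _) (Finset.mem_univ r)

/-- `f` distorts the squared norm of `v` by a factor between `1 - ε` and `1 + ε`. -/
def NearIsometricAt {E F : Type*} [Norm E] [Norm F] (ε : ℝ) (f : E → F) (v : E) : Prop :=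
  |‖f v‖ ^ 2 - ‖v‖ ^ 2| ≤ ε * ‖v‖ ^ 2

/-- Almost-isometry in a direction depends only on the direction. -/
theorem NearIsometricAt.of_smul {E F : Type*} [NormedAddCommGroup E] [NormedSpace ℝ E]
    [NormedAddCommGroup F] [NormedSpace ℝ F] {ε r : ℝ} (hr : r ≠ 0) {f : E →ₗ[ℝ] F} {v : E}
    (h : NearIsometricAt ε f (r • v)) : NearIsometricAt ε f v := by
  have hr2 : 0 < r ^ 2 := by positivity
  unfold NearIsometricAt at *
  rw [map_smul, norm_smul, norm_smul, mul_pow, mul_pow, Real.norm_eq_abs, sq_abs, ← mul_sub,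
    abs_mul, abs_of_pos hr2, mul_left_comm] at h
  exact le_of_mul_le_mul_left h hr2

/-- Polarization: almost-isometry at `x`, `y` and `x + y` makes inner products almost preserved. -/
theorem NearIsometricAt.inner_sub_inner_le {E F : Type*} [NormedAddCommGroup E]
    [InnerProductSpace ℝ E] [NormedAddCommGroup F] [InnerProductSpace ℝ F] {ε : ℝ} (hε : 0 ≤ ε)
    {f : E →ₗ[ℝ] F} {x y : E} (hx : NearIsometricAt ε f x) (hy : NearIsometricAt ε f y)
    (hxy : NearIsometricAt ε f (x + y)) (hx2 : ‖x‖ ≤ 2) (hy1 : ‖y‖ = 1) :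
    ⟪f x, f y⟫ - ⟪x, y⟫ ≤ 7 * ε := by
  unfold NearIsometricAt at *
  rw [map_add] at hxy
  have h1 := norm_add_sq_real (f x) (f y)
  have h2 := norm_add_sq_real x y
  -- The errors add up to `(9 + 4 + 1) ε`, half of which is `7 ε`.
  have h3 : ‖x + y‖ ≤ 3 := (norm_add_le x y).trans (by linarith)
  have h4 : ε * ‖x + y‖ ^ 2 ≤ ε * 3 ^ 2 := by gcongr
  have h5 : ε * ‖x‖ ^ 2 ≤ ε * 2 ^ 2 := by gcongr
  have h6 := (abs_le.1 hx).1
  have h7 := (abs_le.1 hy).1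
  have h8 := (abs_le.1 hxy).2
  rw [hy1] at h7 h2
  linarith

/-- A linear map that is almost isometric at `e_j`, at the vectors of a set norming the coordinates in
`T`, and at their sums with `e_j`, has the `j`-th column of its Gram matrix close on `T` to that of
the identity. -/
theorem sum_sq_gram_sub_one_le {n m : ℕ} {ε : ℝ} (hε : 0 ≤ ε) {T : Finset (Fin n)}
    {s : Finset (EuclideanSpace ℝ (Fin n))} (hs : ∀ x ∈ s, ‖x‖ ≤ 2)
    (hnorming : ∀ g : Fin n → ℝ, ∃ x ∈ s, 3 / 4 * √(∑ i ∈ T, g i ^ 2) ≤ ∑ i, x i * g i)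
    {f : EuclideanSpace ℝ (Fin n) →ₗ[ℝ] EuclideanSpace ℝ (Fin m)} {j : Fin n}
    (hj : NearIsometricAt ε f (EuclideanSpace.single j 1))
    (hx : ∀ x ∈ s, NearIsometricAt ε f x)
    (hxj : ∀ x ∈ s, NearIsometricAt ε f (x + EuclideanSpace.single j 1)) :
    ∑ i ∈ T, (⟪f (EuclideanSpace.single i 1), f (EuclideanSpace.single j 1)⟫ -
      if i = j then 1 else 0) ^ 2 ≤ 100 * ε ^ 2 := by
  obtain ⟨x, hxs, h⟩ := hnorming fun i =>
    ⟪f (EuclideanSpace.single i 1), f (EuclideanSpace.single j 1)⟫ - if i = j then 1 else 0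
  have hfx : f x = ∑ i, x i • f (EuclideanSpace.single i 1) := by
    conv_lhs => rw [← (EuclideanSpace.basisFun (Fin n) ℝ).sum_repr x]
    simp
  have hpair : ∑ i, x i * (⟪f (EuclideanSpace.single i 1), f (EuclideanSpace.single j 1)⟫ -
      if i = j then 1 else 0) =
      ⟪f x, f (EuclideanSpace.single j 1)⟫ - ⟪x, EuclideanSpace.single j (1 : ℝ)⟫ := by
    rw [hfx, sum_inner]
    simp [mul_sub, Finset.sum_sub_distrib, inner_smul_left, EuclideanSpace.inner_single_right]
  rw [hpair] at h
  have h7 := (hx x hxs).inner_sub_inner_le hε hj (hxj x hxs) (hs x hxs) (by simp)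
  rw [← Real.sqrt_le_sqrt_iff (by positivity)]
  calc _ ≤ 10 * ε := by linarith
    _ = _ := by
      rw [show 100 * ε ^ 2 = (10 * ε) ^ 2 by ring, Real.sqrt_sq (by positivity)]

/-! ### Test directions and the dimension bound -/

/-- A family of directions, few in number, at which a linear map to `ℝ^m` can be almost isometric
only if `m` is large. -/
theorem exists_finset_directions (n h : ℕ) (hn : 0 < n) (hh : 0 < h) (hhn : h ≤ n) :
    ∃ D : Finset (EuclideanSpace ℝ (Fin n)), D.card ≤ n * ((n + 1) * 5 ^ h) ∧
      ∀ ε : ℝ, 0 < ε → ε < 1 / 2 →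
      ∀ (m : ℕ) (f : EuclideanSpace ℝ (Fin n) →ₗ[ℝ] EuclideanSpace ℝ (Fin m)),
        (∀ i, NearIsometricAt ε f (EuclideanSpace.single i 1)) →
        (∀ v ∈ D, NearIsometricAt ε f v) →
        min (n : ℝ) ((ε ^ 2)⁻¹ * h) ≤ 808 * m := by
  classical
  let T : ℕ → Finset (Fin n) := fun t => Finset.univ.filter fun i => i.val / h = t
  have hT : ∀ t, (T t).card ≤ h := by
    intro t
    rw [← Finset.card_range h]
    refine Finset.card_le_card_of_injOn (fun i => i.val % h)
      (fun i _ => by simpa using Nat.mod_lt _ hh) fun i hi k hk hik => ?_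
    simp only [T, Finset.coe_filter, Finset.mem_univ, true_and, Set.mem_ofPred_eq] at hi hk
    have h1 := Nat.div_add_mod i.val h
    have h2 := Nat.div_add_mod k.val h
    rw [hi] at h1
    rw [hk] at h2
    simp only at hik
    ext
    omega
  -- The number `⌈n / h⌉` of nonempty blocks.
  let q := (n - 1) / h + 1
  have hqh : q * h ≤ 2 * n := by
    have := Nat.div_mul_le_self (n - 1) h
    simp only [q, add_mul, one_mul]
    omega
  have hqn : q ≤ n := by
    have := Nat.div_le_self (n - 1) h
    simp only [q]
    omega
  choose s hcard hs hnorming using fun t => exists_finset_norming_coordinates (T t)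
  let D : Finset (EuclideanSpace ℝ (Fin n)) := (Finset.range q).biUnion fun t =>
    s t ∪ Finset.univ.biUnion fun j => (s t).image fun x => x + EuclideanSpace.single j (1 : ℝ)
  refine ⟨D, ?_, fun ε hε hε2 m f hbasis hD => ?_⟩
  · have hst : ∀ t, (s t).card ≤ 5 ^ h := fun t =>
      (hcard t).trans (Nat.pow_le_pow_right (by norm_num) (hT t))
    have hDt : ∀ t, (s t ∪ Finset.univ.biUnion fun j : Fin n =>
        (s t).image fun x => x + EuclideanSpace.single j (1 : ℝ)).card ≤ (n + 1) * 5 ^ h := by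
      intro t
      refine (Finset.card_union_le _ _).trans ?_
      have := Finset.card_biUnion_le_card_mul (Finset.univ : Finset (Fin n))
        (fun j => (s t).image fun x => x + EuclideanSpace.single j (1 : ℝ)) (5 ^ h)
        fun j _ => Finset.card_image_le.trans (hst t)
      rw [Finset.card_univ, Fintype.card_fin] at this
      have := hst t
      linarith
    calc D.card ≤ (Finset.range q).card * ((n + 1) * 5 ^ h) :=
          Finset.card_biUnion_le_card_mul _ _ _ fun t _ => hDt t
      _ ≤ _ := by rw [Finset.card_range]; gcongr
  let a : Fin n → EuclideanSpace ℝ (Fin m) := fun i => f (EuclideanSpace.single i 1)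
  let B : Fin n → Fin n → ℝ := fun i j => ⟪a i, a j⟫ - if i = j then 1 else 0
  have hblock : ∀ j, ∀ t ∈ Finset.range q, ∑ i ∈ T t, B i j ^ 2 ≤ 100 * ε ^ 2 := by
    intro j t ht
    refine sum_sq_gram_sub_one_le hε.le (hs t) (hnorming t) (hbasis j) ?_ ?_
    · exact fun x hx => hD x (Finset.mem_biUnion.2 ⟨t, ht, Finset.mem_union_left _ hx⟩)
    · exact fun x hx => hD _ (Finset.mem_biUnion.2 ⟨t, ht, Finset.mem_union_right _
        (Finset.mem_biUnion.2 ⟨j, Finset.mem_univ _, Finset.mem_image_of_mem _ hx⟩)⟩)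
  have hcol : ∀ j, ∑ i, B i j ^ 2 ≤ q * (100 * ε ^ 2) := by
    intro j
    rw [← Finset.sum_fiberwise_of_maps_to (s := Finset.univ) (t := Finset.range q)
      (g := fun i : Fin n => i.val / h)
      (fun i _ => by
        have : i.val / h ≤ (n - 1) / h := Nat.div_le_div_right (by omega)
        simp only [q, Finset.mem_range]
        omega)]
    refine (Finset.sum_le_sum (hblock j)).trans ?_
    simp
  have hB : ∑ j, ∑ i, B i j ^ 2 ≤ n * (q * (100 * ε ^ 2)) := by
    refine (Finset.sum_le_sum fun j _ => hcol j).trans ?_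
    simp
  have ha : ∀ i, 1 - ε ≤ ‖a i‖ ^ 2 ∧ ‖a i‖ ^ 2 ≤ 1 + ε := by
    intro i
    have := hbasis i
    simp only [NearIsometricAt, PiLp.norm_single, norm_one, one_pow, mul_one] at this
    have := abs_le.1 this
    constructor <;> simp only [a] <;> linarith
  have htr_lower : (n : ℝ) / 2 ≤ ∑ i, ‖a i‖ ^ 2 := by
    have := Finset.card_nsmul_le_sum Finset.univ (fun i => ‖a i‖ ^ 2) (1 / 2)
      fun i _ => by linarith [(ha i).1]
    simp only [Finset.card_univ, Fintype.card_fin, nsmul_eq_mul] at this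
    linarith
  have htr_upper : ∑ i, ‖a i‖ ^ 2 ≤ n * (3 / 2) := by
    have := Finset.sum_le_card_nsmul Finset.univ (fun i => ‖a i‖ ^ 2) (3 / 2)
      fun i _ => by linarith [(ha i).2]
    simpa using this
  -- `‖G‖_F² = ‖G - I‖_F² + 2 tr G - n`.
  have hgram : ∑ j, ∑ i, ⟪a j, a i⟫ ^ 2 = ∑ j, ∑ i, B i j ^ 2 + 2 * ∑ i, ‖a i‖ ^ 2 - n := by
    have : ∀ j i, ⟪a j, a i⟫ ^ 2 =
        B i j ^ 2 + (if i = j then 2 * ‖a i‖ ^ 2 - 1 else 0) := by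
      intro j i
      simp only [B]
      split_ifs with hij
      · subst hij
        rw [real_inner_self_eq_norm_sq]
        ring
      · rw [real_inner_comm]; ring
    simp only [this, Finset.sum_add_distrib]
    simp [Finset.sum_sub_distrib, Finset.mul_sum]
    ring
  have hmain := sq_sum_norm_sq_le_card_mul_sum_inner_sq a
  rw [hgram, Fintype.card_fin] at hmain
  have hnR : (0 : ℝ) < n := by exact_mod_cast hn
  have hhR : (0 : ℝ) < h := by exact_mod_cast hh
  have hqhR : (q : ℝ) * h ≤ 2 * n := by exact_mod_cast hqh
  have hqR : (q : ℝ) ≤ 2 * n / h := by rwa [le_div_iff₀ hhR]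
  have hkey : ((n : ℝ) / 2) ^ 2 ≤ m * (n * (2 * n / h * (100 * ε ^ 2)) + 2 * n) := by
    refine (pow_le_pow_left₀ (by positivity) htr_lower 2).trans (hmain.trans ?_)
    gcongr
    have : n * (q * (100 * ε ^ 2)) ≤ n * (2 * n / h * (100 * ε ^ 2)) := by gcongr
    linarith
  -- Multiplying by `μ` and using `μ ε² ≤ h` and `μ ≤ n` leaves `200 + 2`, and `4 * 202 = 808`.
  set μ := min (n : ℝ) ((ε ^ 2)⁻¹ * h)
  have hμ : 0 < μ := lt_min hnR (by positivity)
  have hμn : μ ≤ n := min_le_left _ _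
  have hμh : μ * ε ^ 2 ≤ h := by
    have hμr : μ ≤ (ε ^ 2)⁻¹ * h := min_le_right _ _
    rwa [inv_mul_eq_div, le_div_iff₀ (by positivity)] at hμr
  have h1 : μ * (n * (2 * n / h * (100 * ε ^ 2))) ≤ 200 * n ^ 2 := by
    calc _ = 200 * n ^ 2 * (μ * ε ^ 2 / h) := by ring
      _ ≤ 200 * n ^ 2 * 1 := by gcongr; rwa [div_le_one hhR]
      _ = _ := mul_one _
  have h2 : μ * (2 * n) ≤ 2 * n ^ 2 := by nlinarith
  have h3 : μ * ((n : ℝ) / 2) ^ 2 ≤ m * (202 * n ^ 2) := by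
    calc _ ≤ μ * (m * (n * (2 * n / h * (100 * ε ^ 2)) + 2 * n)) := by gcongr
      _ = m * (μ * (n * (2 * n / h * (100 * ε ^ 2))) + μ * (2 * n)) := by ring
      _ ≤ _ := by gcongr; linarith
  have h4 : n ^ 2 * μ ≤ n ^ 2 * (808 * (m : ℝ)) := by linarith
  exact le_of_mul_le_mul_left h4 (by positivity)

/-- Any finite set of directions can be completed to a set of given cardinality on a sphere. -/
theorem exists_finset_sphere_superset_directions {E : Type*} [NormedAddCommGroup E]
    [NormedSpace ℝ E] (hE : 1 < Module.rank ℝ E) (D : Finset E) {N : ℕ} (hN : D.card ≤ N) {r : ℝ}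
    (hr : 0 < r) :
    ∃ W : Finset E, W.card = N ∧ (∀ w ∈ W, ‖w‖ = r) ∧
      ∀ v ∈ D, v ≠ 0 → ∃ t : ℝ, t ≠ 0 ∧ t • v ∈ W := by
  classical
  let D' := (D.filter (· ≠ 0)).image fun v => (r / ‖v‖) • v
  have hD' : (D' : Set E) ⊆ Metric.sphere 0 r := by
    intro w hw
    obtain ⟨v, hv, rfl⟩ := Finset.mem_image.1 (Finset.mem_coe.1 hw)
    have hv0 : ‖v‖ ≠ 0 := norm_ne_zero_iff.2 (Finset.mem_filter.1 hv).2
    rw [mem_sphere_zero_iff_norm, norm_smul, norm_div, norm_norm, Real.norm_of_nonneg hr.le,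
      div_mul_cancel₀ _ hv0]
  have hinf : (Metric.sphere (0 : E) r).Infinite := by
    have : Nontrivial E := rank_pos_iff_nontrivial.1 (zero_lt_one.trans hE)
    refine (isPreconnected_sphere hE 0 r).infinite_of_nontrivial ?_
    obtain ⟨x, hx⟩ := NormedSpace.sphere_nonempty (E := E) (x := 0) |>.2 hr.le
    refine ⟨x, hx, -x, by simpa using hx, fun h => ?_⟩
    have hx0 : x = 0 := by
      have h2 : (2 : ℝ) • x = 0 := by
        rw [two_smul]
        exact add_eq_zero_iff_eq_neg.2 h
      exact (smul_eq_zero.1 h2).resolve_left two_ne_zero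
    rw [mem_sphere_zero_iff_norm, hx0, norm_zero] at hx
    exact hr.ne hx
  obtain ⟨W, hDW, hWs, hWcard⟩ := hinf.exists_superset_ncard_eq hD' D'.finite_toSet (k := N) (by
    rw [Set.ncard_coe_finset]
    exact (Finset.card_image_le.trans (Finset.card_filter_le _ _)).trans hN)
  -- An infinite set has `ncard` zero, so `N = 0` says nothing about finiteness.
  have hWfin : W.Finite ∨ N = 0 := by
    rcases Nat.eq_zero_or_pos N with h | h
    · exact Or.inr h
    · exact Or.inl (Set.finite_of_ncard_pos (hWcard ▸ h))
  rcases hWfin with hWfin | rfl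
  · refine ⟨hWfin.toFinset, by rw [← Set.ncard_eq_toFinset_card _ hWfin, hWcard],
      fun w hw => mem_sphere_zero_iff_norm.1 (hWs (hWfin.mem_toFinset.1 hw)), fun v hv hv0 => ?_⟩
    refine ⟨r / ‖v‖, div_ne_zero hr.ne' (norm_ne_zero_iff.2 hv0), hWfin.mem_toFinset.2 (hDW ?_)⟩
    exact Finset.mem_image_of_mem _ (Finset.mem_filter.2 ⟨hv, hv0⟩)
  · have hD0 : D = ∅ := by simpa using hN
    exact ⟨∅, by simp [hD0]⟩

/-- At most `n ^ 3` directions at which a linear map to `ℝ^m` can be almost isometric only if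
`m` is at least of order `min n (ε⁻² log n)`. -/
theorem exists_finset_directions_log (n : ℕ) (hn : 1 < n) :
    ∃ D : Finset (EuclideanSpace ℝ (Fin n)), D.card ≤ n ^ 3 ∧
      ∀ ε : ℝ, 0 < ε → ε < 1 / 2 →
      ∀ (m : ℕ) (f : EuclideanSpace ℝ (Fin n) →ₗ[ℝ] EuclideanSpace ℝ (Fin m)),
        (∀ i, NearIsometricAt ε f (EuclideanSpace.single i 1)) →
        (∀ v ∈ D, NearIsometricAt ε f v) →
        min (n : ℝ) ((ε ^ 2)⁻¹ * Real.log n) ≤ 5000 * m := by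
  -- For `n < 10` it is enough that `m ≠ 0`; from `10` on, the block size below is positive.
  rcases lt_or_ge n 10 with hn10 | hn10
  · refine ⟨∅, by simp, fun ε hε hε2 m f hbasis _ => (min_le_left _ _).trans ?_⟩
    have hm : 1 ≤ m := by
      rw [Nat.one_le_iff_ne_zero]
      rintro rfl
      have h := hbasis ⟨0, by omega⟩
      rw [NearIsometricAt, Subsingleton.elim (f _) 0] at h
      norm_num at h
      linarith
    have hmR : (1 : ℝ) ≤ m := by exact_mod_cast hm
    have hnR : (n : ℝ) < 10 := by exact_mod_cast hn10
    linarith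
  -- `2 * 5 ^ h ≤ n` gives `(n + 1) * 5 ^ h ≤ n ^ 2`.
  let h := Nat.log 5 (n / 2)
  have hh : 0 < h := Nat.log_pos (by norm_num) (by omega)
  have hpow : 5 ^ h ≤ n / 2 := Nat.pow_log_le_self 5 (by omega)
  have hlt : n / 2 < 5 ^ (h + 1) := Nat.lt_pow_succ_log_self (by norm_num) _
  have hhn : h ≤ n := (Nat.lt_pow_self (by norm_num : 1 < 5)).le.trans (by omega)
  obtain ⟨D, hcard, hD⟩ := exists_finset_directions n h (by omega) hh hhn
  refine ⟨D, hcard.trans ?_, fun ε hε hε2 m f hbasis hfD => ?_⟩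
  · have h1 : (n + 1) * 5 ^ h ≤ n * n := by
      have : 2 * 5 ^ h ≤ n := by omega
      nlinarith
    calc n * ((n + 1) * 5 ^ h) ≤ n * (n * n) := Nat.mul_le_mul_left _ h1
      _ = n ^ 3 := by ring
  have hlog : Real.log n ≤ 5 * h := by
    have hnlt : (n : ℝ) ≤ 2 * 5 ^ (h + 1) := by
      exact_mod_cast (show n ≤ 2 * 5 ^ (h + 1) by omega)
    have he : (2.7 : ℝ) ≤ Real.exp 1 := by linarith [Real.exp_one_gt_d9]
    have h2 : (2 : ℝ) ≤ Real.exp 1 := by linarith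
    have h5 : (5 : ℝ) ≤ Real.exp 2 := by
      rw [show (2 : ℝ) = 1 + 1 by norm_num, Real.exp_add]
      nlinarith
    have hhR : (1 : ℝ) ≤ h := by exact_mod_cast hh
    have hn0 : (0 : ℝ) < n := by exact_mod_cast (by omega : 0 < n)
    rw [Real.log_le_iff_le_exp hn0]
    calc (n : ℝ) ≤ Real.exp 1 * Real.exp 2 ^ (h + 1) := hnlt.trans (by gcongr)
      _ = Real.exp (1 + (h + 1 : ℕ) * 2) := by rw [Real.exp_add, Real.exp_nat_mul]
      _ ≤ Real.exp (5 * h) := Real.exp_le_exp.2 (by push_cast; linarith)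
  have hmin := hD ε hε hε2 m f hbasis hfD
  have hε' : 0 < (ε ^ 2)⁻¹ := by positivity
  have hm0 : (0 : ℝ) ≤ m := Nat.cast_nonneg m
  rcases min_le_iff.1 hmin with hle | hle
  · exact (min_le_left _ _).trans (by linarith)
  · refine (min_le_right _ _).trans ?_
    calc (ε ^ 2)⁻¹ * Real.log n ≤ (ε ^ 2)⁻¹ * (5 * h) := by gcongr
      _ = 5 * ((ε ^ 2)⁻¹ * h) := by ring
      _ ≤ _ := by linarith

/-! ### Assembly of the point set -/

theorem log_pow_three_add_self_le (n : ℕ) (hn : 1 < n) :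
    Real.log ((n ^ 3 + n : ℕ) : ℝ) ≤ 4 * Real.log n := by
  have hle : n ^ 3 + n ≤ n ^ 4 := by
    have : n * 1 ≤ n * n ^ 2 := Nat.mul_le_mul_left _ (Nat.one_le_pow _ _ (by omega))
    have : n ^ 3 * 2 ≤ n ^ 3 * n := Nat.mul_le_mul_left _ hn
    nlinarith
  calc Real.log ((n ^ 3 + n : ℕ) : ℝ) ≤ Real.log ((n ^ 4 : ℕ) : ℝ) :=
        Real.log_le_log (by exact_mod_cast (by positivity)) (by exact_mod_cast hle)
    _ = 4 * Real.log n := by push_cast; rw [Real.log_pow]; norm_num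

theorem nearIsometricAt_iff {E F : Type*} [Norm E] [Norm F] {ε : ℝ} {f : E → F} {v : E} :
    NearIsometricAt ε f v ↔
      (1 - ε) * ‖v‖ ^ 2 ≤ ‖f v‖ ^ 2 ∧ ‖f v‖ ^ 2 ≤ (1 + ε) * ‖v‖ ^ 2 := by
  rw [NearIsometricAt, abs_le]
  constructor <;> rintro ⟨h1, h2⟩ <;> constructor <;> linarith

theorem mainTheorem1 :
    ∃ c : ℝ, 0 < c ∧ ∃ C : ℝ, 0 < C ∧
      ∀ n : ℕ, 1 < n → ∀ ε : ℝ, 0 < ε → ε < 1 / 2 →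
        ∃ V : Finset (EuclideanSpace ℝ (Fin n)),
          V.card = n ^ 3 + n ∧
          (∀ i : Fin n, EuclideanSpace.single i (1 : ℝ) ∈ V) ∧
          (∀ v ∈ V, (∃ i : Fin n, v = EuclideanSpace.single i (1 : ℝ)) ∨
            |‖v‖ ^ 2 - (n : ℝ)| ≤ C * Real.sqrt ((n : ℝ) * Real.log (n : ℝ))) ∧
          (∀ (m : ℕ) (A : Matrix (Fin m) (Fin n) ℝ),
            PreservesNorms ε A (V : Set (EuclideanSpace ℝ (Fin n))) →
              c * min (n : ℝ) ((ε ^ 2)⁻¹ * Real.log (n : ℝ)) ≤ (m : ℝ) ∧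
              c * min (n : ℝ) ((ε ^ 2)⁻¹ * Real.log (V.card : ℝ)) ≤ (m : ℝ)) ∧
          (∀ (m : ℕ) (f : EuclideanSpace ℝ (Fin n) →ₗ[ℝ] EuclideanSpace ℝ (Fin m)),
            HasJLGuarantee ε (insert 0 (V : Set (EuclideanSpace ℝ (Fin n)))) f →
              c * min (n : ℝ) ((ε ^ 2)⁻¹ * Real.log (n : ℝ)) ≤ (m : ℝ) ∧
              c * min (n : ℝ) ((ε ^ 2)⁻¹ * Real.log (V.card : ℝ)) ≤ (m : ℝ)) := by
  -- `20000 = 4 * 5000`, as `log N ≤ 4 log n`. Any `C > 0` works, the norms being exactly `√n`.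
  refine ⟨1 / 20000, by norm_num, 1, one_pos, fun n hn ε hε hε2 => ?_⟩
  classical
  have hn0 : (0 : ℝ) < n := by exact_mod_cast (by omega : 0 < n)
  have hrank : 1 < Module.rank ℝ (EuclideanSpace ℝ (Fin n)) := by
    rw [← Module.finrank_eq_rank, finrank_euclideanSpace_fin]
    exact_mod_cast hn
  obtain ⟨D, hDcard, hD⟩ := exists_finset_directions_log n hn
  obtain ⟨W, hWcard, hWnorm, hWD⟩ :=
    exists_finset_sphere_superset_directions hrank D hDcard (Real.sqrt_pos.2 hn0)
  let S : Finset (EuclideanSpace ℝ (Fin n)) :=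
    Finset.univ.image fun i => EuclideanSpace.single i (1 : ℝ)
  have hScard : S.card = n := by
    rw [Finset.card_image_of_injective _ fun i j hij => ?_, Finset.card_univ, Fintype.card_fin]
    by_contra hne
    have := congrArg (fun v : EuclideanSpace ℝ (Fin n) => v i) hij
    simp [hne] at this
  have hdisj : Disjoint W S := by
    rw [Finset.disjoint_left]
    intro w hw hwS
    obtain ⟨i, -, rfl⟩ := Finset.mem_image.1 hwS
    have h1 := hWnorm _ hw
    rw [PiLp.norm_single, norm_one, eq_comm, Real.sqrt_eq_one] at h1
    have : n = 1 := by exact_mod_cast h1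
    omega
  have hVcard : (W ∪ S).card = n ^ 3 + n := by
    rw [Finset.card_union_of_disjoint hdisj, hWcard, hScard]
  have hSV : ∀ i, EuclideanSpace.single i (1 : ℝ) ∈ W ∪ S := fun i =>
    Finset.mem_union_right _ (Finset.mem_image_of_mem _ (Finset.mem_univ i))
  have hbound : ∀ (m : ℕ) (f : EuclideanSpace ℝ (Fin n) →ₗ[ℝ] EuclideanSpace ℝ (Fin m)),
      (∀ v ∈ W ∪ S, NearIsometricAt ε f v) →
        1 / 20000 * min (n : ℝ) ((ε ^ 2)⁻¹ * Real.log (n : ℝ)) ≤ (m : ℝ) ∧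
        1 / 20000 * min (n : ℝ) ((ε ^ 2)⁻¹ * Real.log ((W ∪ S).card : ℝ)) ≤ (m : ℝ) := by
    intro m f hf
    have hmin := hD ε hε hε2 m f (fun i => hf _ (hSV i)) fun v hv => by
      rcases eq_or_ne v 0 with rfl | hv0
      · simp [NearIsometricAt]
      · obtain ⟨t, ht, htW⟩ := hWD v hv hv0
        exact (hf _ (Finset.mem_union_left _ htW)).of_smul ht
    have hm0 : (0 : ℝ) ≤ m := Nat.cast_nonneg m
    refine ⟨by linarith, ?_⟩
    suffices h : min (n : ℝ) ((ε ^ 2)⁻¹ * Real.log ((W ∪ S).card : ℝ)) ≤ 20000 * m by linarith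
    have hlog := log_pow_three_add_self_le n hn
    rw [hVcard]
    rcases min_le_iff.1 hmin with hle | hle
    · exact (min_le_left _ _).trans (by linarith)
    · refine (min_le_right _ _).trans ?_
      calc _ ≤ (ε ^ 2)⁻¹ * (4 * Real.log n) := by gcongr
        _ = 4 * ((ε ^ 2)⁻¹ * Real.log n) := by ring
        _ ≤ _ := by linarith
  refine ⟨W ∪ S, hVcard, hSV, fun v hv => ?_, fun m A hA => ?_, fun m f hf => ?_⟩
  · rcases Finset.mem_union.1 hv with hv | hv
    · right
      rw [hWnorm v hv, Real.sq_sqrt hn0.le, sub_self, abs_zero]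
      positivity
    · obtain ⟨i, -, rfl⟩ := Finset.mem_image.1 hv
      exact Or.inl ⟨i, rfl⟩
  · refine hbound m (Matrix.toLpLin 2 2 A) fun v hv => nearIsometricAt_iff.2 ?_
    exact hA v (Finset.mem_coe.2 hv)
  · refine hbound m f fun v hv => nearIsometricAt_iff.2 ?_
    simpa using hf v (Set.mem_insert_of_mem _ (Finset.mem_coe.2 hv)) 0 (Set.mem_insert _ _)
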